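/- Let $\boldsymbol\mu\in\mathbb{R}^n$ and $\boldsymbol\nu\in\mathbb{R}^m$ be probability vectors, let $\mathbf{T}\in\Pi(\boldsymbol\mu,\boldsymbol\nu)=\{\mathbf{T}\in\mathbb{R}^{n\times m}:\mathbf{T}_{i,j}\ge 0,\ \mathbf{T}\mathbf{1}_m=\boldsymbol\mu,\ \mathbf{T}^\top\mathbf{1}_n=\boldsymbol\nu\}$ be a transport plan (for instance the solution of an entropy-regularized optimal transport problem with these marginals), and let $f:\mathbb{R}^{n\times m}\to\mathbb{R}$ be differentiable at $\mathbf{T}$ with gradient $\nabla_{\mathbf{T}}f$. Consider the adjoint linear system $\mathbf{A}\mathbf{y}=\mathbf{b}$ in $\mathbb{R}^{n+m}$ with $$\mathbf{A}=\begin{bmatrix}\operatorname{diag}(\boldsymbol\mu)&\mathbf{T}\\ \mathbf{T}^\top&\operatorname{diag}(\boldsymbol\nu)\end{bmatrix},\qquad \mathbf{b}=\begin{bmatrix}(\mathbf{T}\odot\nabla_{\mathbf{T}}f)\mathbf{1}_m\\ (\mathbf{T}\odot\nabla_{\mathbf{T}}f)^\top\mathbf{1}_n\end{bmatrix},$$ where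 $\odot$ is the entrywise product. Then $\mathbf{A}$ has nonzero eigenvalues, and all of them are positive. Let $\lambda_1$ and $\lambda_r$ be the largest and the smallest nonzero eigenvalue of $\mathbf{A}$, and put $$\rho=\frac{\sqrt{\lambda_1/\lambda_r}-1}{\sqrt{\lambda_1/\lambda_r}+1}\in[0,1).$$ For every starting vector $\mathbf{y}^{(0)}\in\mathbb{R}^{n+m}$, the conjugate gradient method for $\mathbf{A}\mathbf{y}=\mathbf{b}$ (in exact arithmetic, stopped, i.e. continued constantly, once the residual is $0$) is well defined: as long as the residual is nonzero, the search direction $\mathbf{p}$ satisfies $\mathbf{p}^\top\mathbf{A}\mathbf{p}>0$. Its iterates $\mathbf{y}^{(k)}$ converge to a solution of the system linearly with rate $\rho$. More precisely, with $\|\mathbf{v}\|_{\mathbf{A}}=\sqrt{\mathbf{v}^\top\mathbf{A}\mathbf{v}}$, every solution $\mathbf{y}$ of $\mathbf{A}\mathbf{y}=\mathbf{b}$ satisfies $$\|\mathbf{y}^{(k)}-\mathbf{y}\|_{\mathbf{A}}\le 2\rho^k\,\|\mathbf{y}^{(0)}-\mathbf{y}\|_{\mathbf{A}}\qquad(k\ge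 0),$$ and there is a solution $\mathbf{y}^*$ with $\mathbf{y}^{(k)}\to\mathbf{y}^*$ and $$\|\mathbf{y}^{(k)}-\mathbf{y}^*\|_2\le 2\sqrt{\lambda_1/\lambda_r}\;\rho^k\,\|\mathbf{y}^{(0)}-\mathbf{y}^*\|_2\qquad(k\ge 0).$$ -/

import Mathlib

open scoped Matrix

/-- `T` is a transport plan between `μ` and `ν`, i.e. `T ∈ Π(μ, ν)`:
nonnegative entries, row sums `T 1 = μ` and column sums `Tᵀ 1 = ν`. -/
structure IsTransportPlan {n m : ℕ} (μ : Fin n → ℝ) (ν : Fin m → ℝ)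
    (T : Matrix (Fin n) (Fin m) ℝ) : Prop where
  nonneg : ∀ i j, 0 ≤ T i j
  row_sum : T *ᵥ 1 = μ
  col_sum : Tᵀ *ᵥ 1 = ν

/-- `G = ∇f(T)`: the function `f` of an `n × m` matrix is (Fréchet) differentiable at `T`, with
gradient `G` for the entrywise (Frobenius) inner product. Matrices are viewed as elements of the
Euclidean space `ℝ^(n × m)`. -/
def HasMatrixGradientAt {n m : ℕ} (f : Matrix (Fin n) (Fin m) ℝ → ℝ)
    (G T : Matrix (Fin n) (Fin m) ℝ) : Prop :=
  HasGradientAt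
    (fun x : EuclideanSpace ℝ (Fin n × Fin m) => f (Matrix.of fun i j => x (i, j)))
    (WithLp.toLp 2 fun q : Fin n × Fin m => G q.1 q.2)
    (WithLp.toLp 2 fun q : Fin n × Fin m => T q.1 q.2)

/-- The coefficient matrix `A = [diag μ, T; Tᵀ, diag ν]` of the adjoint system. -/
def adjointMatrix {n m : ℕ} (μ : Fin n → ℝ) (ν : Fin m → ℝ) (T : Matrix (Fin n) (Fin m) ℝ) :
    Matrix (Fin n ⊕ Fin m) (Fin n ⊕ Fin m) ℝ :=
  Matrix.fromBlocks (Matrix.diagonal μ) T Tᵀ (Matrix.diagonal ν)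

/-- The right-hand side `b = [(T ⊙ G) 1; (T ⊙ G)ᵀ 1]` of the adjoint system, with `G = ∇f(T)`. -/
def adjointRhs {n m : ℕ} (T G : Matrix (Fin n) (Fin m) ℝ) : Fin n ⊕ Fin m → ℝ :=
  Sum.elim ((T ⊙ G) *ᵥ 1) ((T ⊙ G)ᵀ *ᵥ 1)

/-- The state of the conjugate gradient method: iterate, residual, search direction. -/
structure CGState (ι : Type*) where
  /-- the current iterate -/
  iter : ι → ℝ
  /-- the current residual -/
  res : ι → ℝ
  /-- the current search direction -/
  dir : ι → ℝ

open Classical in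
/-- One step of the conjugate gradient method for the coefficient matrix `A`:
`a = (r·r)/(p·Ap)`, `x' = x + a p`, `r' = r - a Ap`, `c = (r'·r')/(r·r)`, `p' = r' + c p`.
When the residual is `0` the method has terminated and the state no longer changes. -/
noncomputable def cgStep {ι : Type*} [Fintype ι] (A : Matrix ι ι ℝ) (s : CGState ι) :
    CGState ι :=
  if s.res = 0 then s
  else
    let a : ℝ := (s.res ⬝ᵥ s.res) / (s.dir ⬝ᵥ (A *ᵥ s.dir))
    let r' : ι → ℝ := s.res - a • (A *ᵥ s.dir)
    let c : ℝ := (r' ⬝ᵥ r') / (s.res ⬝ᵥ s.res)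
    { iter := s.iter + a • s.dir
      res := r'
      dir := r' + c • s.dir }

/-- The state after `k` steps of the conjugate gradient method for `A y = b` started at `y₀`
(initial residual and initial direction `b - A y₀`). -/
noncomputable def cgState {ι : Type*} [Fintype ι] (A : Matrix ι ι ℝ) (b y₀ : ι → ℝ) :
    ℕ → CGState ι
  | 0 => { iter := y₀, res := b - A *ᵥ y₀, dir := b - A *ᵥ y₀ }
  | k + 1 => cgStep A (cgState A b y₀ k)

/-- The `k`-th conjugate gradient iterate `y⁽ᵏ⁾` for `A y = b` started at `y₀`. -/
noncomputable def cgIter {ι : Type*} [Fintype ι] (A : Matrix ι ι ℝ) (b y₀ : ι → ℝ) (k : ℕ) :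
    ι → ℝ :=
  (cgState A b y₀ k).iter

/-- The energy (semi)norm `‖v‖_A = √(vᵀ A v)`. In an orthonormal eigenbasis of a positive
semidefinite `A` it is `√(wᵀ Λ w)`, where `Λ` is the diagonal matrix of the nonzero eigenvalues and
`w` the corresponding coordinates of `v`. -/
noncomputable def energyNorm {ι : Type*} [Fintype ι] (A : Matrix ι ι ℝ) (v : ι → ℝ) : ℝ :=
  √(v ⬝ᵥ (A *ᵥ v))

/-- The Euclidean norm `‖v‖₂ = √(vᵀ v)`. -/
noncomputable def euclNorm {ι : Type*} [Fintype ι] (v : ι → ℝ) : ℝ :=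
  √(v ⬝ᵥ v)

/-- The set of nonzero (real) eigenvalues of a real square matrix. -/
def nonzeroEigenvalues {ι : Type*} [Fintype ι] [DecidableEq ι] (A : Matrix ι ι ℝ) : Set ℝ :=
  {lam : ℝ | lam ≠ 0 ∧ Module.End.HasEigenvalue (Matrix.toLin' A) lam}

/-- The convergence factor `(√(λ₁/λᵣ) - 1) / (√(λ₁/λᵣ) + 1)`. -/
noncomputable def cgRate (lam₁ lamᵣ : ℝ) : ℝ :=
  (√(lam₁ / lamᵣ) - 1) / (√(lam₁ / lamᵣ) + 1)

/-! The marginal conditions turn the quadratic form of `A` into `∑ T i j * (v_i + v_j) ^ 2`, so `A`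
is positive semidefinite. A kernel vector satisfies `v_i + v_j = 0` wherever `T i j ≠ 0`, and `v ⬝ᵥ
b` is a sum of `G i j * T i j * (v_i + v_j)`. Hence `b` is orthogonal to the kernel, and the rest is
conjugate gradients for a singular but consistent system.

Residuals and directions stay orthogonal to the kernel, so the method effectively runs on the range
of `A`, where the spectrum lies in `[λᵣ, λ₁]` with `λᵣ > 0`. The usual orthogonality and conjugacy
relations make the `k`-th error minimal in energy among the vectors `q(A)(y₀ - y)` with `deg q ≤ k`
and `q(0) = 1` (`energyNorm_cgIter_sub_le_aeval`). A rescaled Chebyshev polynomial bounded by `2ρ^k`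
on `[λᵣ, λ₁]` gives the energy estimate; zero eigenvalues carry no energy. For the solution that
agrees with `y₀` on the kernel, all errors are orthogonal to the kernel, and comparing the two norms
there costs the factor `√(λ₁/λᵣ)`. -/

/-! ### Spectral calculus for real symmetric matrices -/

lemma Matrix.IsHermitian.mulVec_dotProduct_real {ι : Type*} [Fintype ι] {A : Matrix ι ι ℝ}
    (hA : A.IsHermitian) (v w : ι → ℝ) : (A *ᵥ v) ⬝ᵥ w = v ⬝ᵥ (A *ᵥ w) := by
  rw [Matrix.dotProduct_mulVec, ← Matrix.mulVec_transpose]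
  have : Aᵀ = A := by simpa [Matrix.IsHermitian] using hA
  rw [this]

/-- Orthonormal diagonalization of a real symmetric matrix, in terms of the dot product. -/
lemma Matrix.IsHermitian.exists_dotProduct_eigenbasis {ι : Type*} [Fintype ι] [DecidableEq ι]
    {A : Matrix ι ι ℝ} (hA : A.IsHermitian) :
    ∃ (u : ι → ι → ℝ) (l : ι → ℝ), (∀ i, A *ᵥ u i = l i • u i) ∧
      (∀ v w, v ⬝ᵥ w = ∑ i, (u i ⬝ᵥ v) * (u i ⬝ᵥ w)) ∧
      ∀ x, Module.End.HasEigenvalue (Matrix.toLin' A) x ↔ ∃ i, l i = x := by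
  refine ⟨fun i => ⇑(hA.eigenvectorBasis i), hA.eigenvalues, hA.mulVec_eigenvectorBasis, ?_, ?_⟩
  · intro v w
    have h := hA.eigenvectorBasis.sum_inner_mul_inner (WithLp.toLp 2 v) (WithLp.toLp 2 w)
    simp only [EuclideanSpace.inner_eq_star_dotProduct, star_trivial] at h
    rw [dotProduct_comm v w, ← h]
    refine Finset.sum_congr rfl fun i _ => ?_
    congr 1
    exact dotProduct_comm _ _
  · intro x
    rw [Module.End.hasEigenvalue_iff_mem_spectrum, Matrix.spectrum_toLin',
      hA.spectrum_real_eq_range_eigenvalues]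
    rfl

/-- A right-hand side orthogonal to the kernel of a symmetric `A` lies in the range of `A ^ 2`. -/
lemma Matrix.IsHermitian.exists_mulVec_mulVec_eq {ι : Type*} [Fintype ι]
    {A : Matrix ι ι ℝ} (hA : A.IsHermitian) {b : ι → ℝ}
    (hb : ∀ u, A *ᵥ u = 0 → u ⬝ᵥ b = 0) : ∃ w, A *ᵥ (A *ᵥ w) = b := by
  classical
  obtain ⟨u, l, hu, hsum, -⟩ := hA.exists_dotProduct_eigenbasis
  refine ⟨∑ i, ((l i)⁻¹ ^ 2 * (u i ⬝ᵥ b)) • u i, ?_⟩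
  have hexp : b = ∑ i, (u i ⬝ᵥ b) • u i := by
    refine dotProduct_eq _ _ fun w => ?_
    rw [hsum, sum_dotProduct]
    simp
  conv_rhs => rw [hexp]
  simp only [Matrix.mulVec_sum, Matrix.mulVec_smul, hu, smul_smul]
  refine Finset.sum_congr rfl fun i _ => ?_
  by_cases hl : l i = 0
  · have : u i ⬝ᵥ b = 0 := hb _ (by rw [hu, hl, zero_smul])
    simp [this]
  · congr 1
    field_simp

lemma Matrix.mulVec_aeval_of_mulVec_eq_smul {ι : Type*} [Fintype ι] [DecidableEq ι]
    {A : Matrix ι ι ℝ} (hA : A.IsHermitian) {u : ι → ℝ} {l : ℝ} (hu : A *ᵥ u = l • u)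
    (q : Polynomial ℝ) (v : ι → ℝ) :
    u ⬝ᵥ (Polynomial.aeval A q *ᵥ v) = q.eval l * (u ⬝ᵥ v) := by
  induction q using Polynomial.induction_on' with
  | add p q hp hq => simp [Matrix.add_mulVec, dotProduct_add, hp, hq, add_mul]
  | monomial k a =>
    have h : ∀ v : ι → ℝ, u ⬝ᵥ ((A ^ k) *ᵥ v) = l ^ k * (u ⬝ᵥ v) := by
      induction k with
      | zero => simp
      | succ k ih =>
        intro v
        rw [pow_succ, ← Matrix.mulVec_mulVec, ih, ← hA.mulVec_dotProduct_real, hu,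
          smul_dotProduct, smul_eq_mul]
        ring
    rw [Polynomial.aeval_monomial, ← Algebra.smul_def, Matrix.smul_mulVec, dotProduct_smul, h,
      Polynomial.eval_monomial, smul_eq_mul]
    ring

/-! ### Chebyshev polynomials -/

/-- The parametrization `x = (z + z⁻¹) / 2` solves the three-term recurrence and gives the growth of
`T_k` outside `[-1, 1]`. -/
lemma Polynomial.Chebyshev.eval_T_add_inv {z : ℝ} (hz : z ≠ 0) (k : ℕ) :
    (Polynomial.Chebyshev.T ℝ k).eval ((z + z⁻¹) / 2) = (z ^ k + z⁻¹ ^ k) / 2 := by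
  induction k using Nat.twoStepInduction with
  | zero => simp
  | one => simp
  | more k h0 h1 =>
    have : ((k + 2 : ℕ) : ℤ) = (k : ℤ) + 2 := by push_cast; ring
    rw [this, Polynomial.Chebyshev.T_add_two]
    have h1' : ((k + 1 : ℕ) : ℤ) = (k : ℤ) + 1 := by push_cast; ring
    rw [h1'] at h1
    simp only [Polynomial.eval_sub, Polynomial.eval_mul, Polynomial.eval_ofNat,
      Polynomial.eval_X, h0, h1]
    have hz' : z * z⁻¹ = 1 := mul_inv_cancel₀ hz
    generalize z⁻¹ = y at *
    linear_combination (z ^ k + y ^ k) / 2 * hz'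

lemma cgRate_nonneg {a c : ℝ} (hc : 0 < c) (hca : c ≤ a) : 0 ≤ cgRate a c := by
  have h : 1 ≤ √(a / c) := by rw [Real.one_le_sqrt, one_le_div hc]; exact hca
  exact div_nonneg (by linarith) (by linarith)

lemma cgRate_lt_one (a c : ℝ) : cgRate a c < 1 := by
  have h : 0 ≤ √(a / c) := Real.sqrt_nonneg _
  rw [cgRate, div_lt_one (by linarith)]
  linarith

/-- The shifted and rescaled Chebyshev polynomial: small on `[c, a]`, equal to `1` at `0`. -/
lemma exists_polynomial_abs_eval_le_cgRate {a c : ℝ} (hc : 0 < c) (hca : c ≤ a) (k : ℕ) :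
    ∃ q : Polynomial ℝ, q.natDegree ≤ k ∧ q.eval 0 = 1 ∧
      ∀ t, c ≤ t → t ≤ a → |q.eval t| ≤ 2 * cgRate a c ^ k := by
  have hρ := cgRate_nonneg hc hca
  -- If `a = c`, then `ρ = 0` and the rescaling degenerates. For `k > 0` a linear polynomial
  -- vanishing at `c` is needed; for `k = 0` the bound is `2 * 0 ^ 0 = 2`.
  rcases hca.eq_or_lt with rfl | hlt
  · rcases k.eq_zero_or_pos with rfl | hk
    · exact ⟨1, by simp, by simp, by simp⟩
    · refine ⟨1 - Polynomial.C c⁻¹ * Polynomial.X, ?_, by simp, fun t h1 h2 => ?_⟩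
      · refine (Polynomial.natDegree_sub_le _ _).trans ?_
        rw [Polynomial.natDegree_one, Polynomial.natDegree_C_mul_X _ (inv_ne_zero hc.ne')]
        simpa using Nat.one_le_iff_ne_zero.2 hk.ne'
      · obtain rfl : t = c := le_antisymm h2 h1
        simp [hc.ne']
        positivity
  set s := √(a / c) with hs
  have hs1 : 1 < s := by
    rw [hs, Real.lt_sqrt zero_le_one, one_pow, one_lt_div hc]; exact hlt
  have hs2 : s ^ 2 * c = a := by
    rw [hs, Real.sq_sqrt (div_nonneg (hc.le.trans hca) hc.le), div_mul_cancel₀ _ hc.ne']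
  set ρ := cgRate a c with hρd
  have hρ' : ρ = (s - 1) / (s + 1) := rfl
  have hρ0 : 0 < ρ := by rw [hρ']; exact div_pos (by linarith) (by linarith)
  have hac : 0 < a - c := by linarith
  -- The decreasing affine map from `[c, a]` onto `[-1, 1]` sends `0` to `(a + c) / (a - c)`. With
  -- `z = ρ⁻¹` there, `T_k` takes a value of at least `ρ⁻¹ ^ k / 2`, the normalizing constant `M`.
  have hx : (a + c) / (a - c) = (ρ⁻¹ + ρ⁻¹⁻¹) / 2 := by
    have h1 : s + 1 ≠ 0 := by linarith
    have h2 : s - 1 ≠ 0 := by linarith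
    have h3 : s ^ 2 * c - c ≠ 0 := by rw [hs2]; exact hac.ne'
    rw [hρ', inv_inv, inv_div, ← hs2, div_add_div _ _ h2 h1, div_div, div_eq_div_iff h3 (by positivity)]
    ring
  have hT := Polynomial.Chebyshev.eval_T_add_inv (inv_ne_zero hρ0.ne') k
  rw [← hx, inv_inv] at hT
  set M := (Polynomial.Chebyshev.T ℝ k).eval ((a + c) / (a - c)) with hM
  have hMlow : ρ⁻¹ ^ k / 2 ≤ M := by
    rw [hT]
    have : 0 ≤ ρ ^ k := by positivity
    linarith
  have hMpos : 0 < M := lt_of_lt_of_le (by positivity) hMlow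
  refine ⟨Polynomial.C M⁻¹ * (Polynomial.Chebyshev.T ℝ k).comp
    (Polynomial.C (-2 / (a - c)) * Polynomial.X + Polynomial.C ((a + c) / (a - c))), ?_, ?_, ?_⟩
  · refine (Polynomial.natDegree_C_mul_le _ _).trans (Polynomial.natDegree_comp_le.trans ?_)
    rw [Polynomial.Chebyshev.natDegree_T]
    simpa using Nat.mul_le_mul_left k (Polynomial.natDegree_linear_le
      (a := -2 / (a - c)) (b := (a + c) / (a - c)))
  · simp [← hM, hMpos.ne']
  · intro t h1 h2
    have hy : |(-2 / (a - c)) * t + (a + c) / (a - c)| ≤ 1 := by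
      rw [div_mul_eq_mul_div, ← add_div, abs_div, abs_of_pos hac, div_le_one hac, abs_le]
      constructor <;> linarith
    have hq := Polynomial.Chebyshev.abs_eval_T_real_le_one k hy
    simp only [Polynomial.eval_mul, Polynomial.eval_C, Polynomial.eval_comp, Polynomial.eval_add,
      Polynomial.eval_X, abs_mul, abs_inv, abs_of_pos hMpos]
    calc M⁻¹ * _ ≤ M⁻¹ * 1 := by gcongr
      _ ≤ (ρ⁻¹ ^ k / 2)⁻¹ := by rw [mul_one]; gcongr
      _ = 2 * ρ ^ k := by rw [inv_div, inv_pow, div_inv_eq_mul]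

/-! ### The conjugate gradient method -/

section CG

variable {ι : Type*} [Fintype ι] {A : Matrix ι ι ℝ} {b y₀ : ι → ℝ}

lemma cgState_succ_of_res_eq_zero {k : ℕ} (h : (cgState A b y₀ k).res = 0) :
    cgState A b y₀ (k + 1) = cgState A b y₀ k := by
  rw [cgState, cgStep, if_pos h]

/-- The step length of the conjugate gradient method. -/
noncomputable def cgStepLength (s : CGState ι) (A : Matrix ι ι ℝ) : ℝ :=
  (s.res ⬝ᵥ s.res) / (s.dir ⬝ᵥ (A *ᵥ s.dir))

lemma cgState_succ_iter {k : ℕ} (h : (cgState A b y₀ k).res ≠ 0) :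
    (cgState A b y₀ (k + 1)).iter = (cgState A b y₀ k).iter +
      cgStepLength (cgState A b y₀ k) A • (cgState A b y₀ k).dir := by
  rw [cgState, cgStep, if_neg h]; rfl

lemma cgState_succ_res {k : ℕ} (h : (cgState A b y₀ k).res ≠ 0) :
    (cgState A b y₀ (k + 1)).res = (cgState A b y₀ k).res -
      cgStepLength (cgState A b y₀ k) A • (A *ᵥ (cgState A b y₀ k).dir) := by
  rw [cgState, cgStep, if_neg h]; rfl

lemma cgState_succ_dir {k : ℕ} (h : (cgState A b y₀ k).res ≠ 0) :
    (cgState A b y₀ (k + 1)).dir = (cgState A b y₀ (k + 1)).res +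
      (((cgState A b y₀ (k + 1)).res ⬝ᵥ (cgState A b y₀ (k + 1)).res) /
        ((cgState A b y₀ k).res ⬝ᵥ (cgState A b y₀ k).res)) • (cgState A b y₀ k).dir := by
  rw [cgState, cgStep, if_neg h]

lemma res_ne_zero_of_le {j k : ℕ} (hjk : j ≤ k) (h : (cgState A b y₀ k).res ≠ 0) :
    (cgState A b y₀ j).res ≠ 0 := by
  induction k, hjk using Nat.le_induction with
  | base => exact h
  | succ k _ ih =>
    refine ih fun h0 => h ?_
    rw [cgState_succ_of_res_eq_zero h0, h0]

lemma cgState_res_eq (k : ℕ) :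
    (cgState A b y₀ k).res = b - A *ᵥ (cgState A b y₀ k).iter := by
  induction k with
  | zero => rfl
  | succ k ih =>
    by_cases h : (cgState A b y₀ k).res = 0
    · rw [cgState_succ_of_res_eq_zero h, ih]
    · rw [cgState_succ_res h, cgState_succ_iter h, ih, Matrix.mulVec_add, Matrix.mulVec_smul]
      abel

/-- Kernel components are never touched by the method. -/
lemma dotProduct_cgState_of_mulVec_eq_zero (hA : A.IsHermitian)
    (hb : ∀ u, A *ᵥ u = 0 → u ⬝ᵥ b = 0) {u : ι → ℝ} (hu : A *ᵥ u = 0) (k : ℕ) :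
    u ⬝ᵥ (cgState A b y₀ k).res = 0 ∧ u ⬝ᵥ (cgState A b y₀ k).dir = 0 ∧
      u ⬝ᵥ (cgState A b y₀ k).iter = u ⬝ᵥ y₀ := by
  have hres : ∀ k, u ⬝ᵥ (cgState A b y₀ k).res = 0 := fun k => by
    rw [cgState_res_eq, dotProduct_sub, hb u hu, ← hA.mulVec_dotProduct_real, hu]
    simp
  refine ⟨hres k, ?_⟩
  induction k with
  | zero => exact ⟨hres 0, rfl⟩
  | succ k ih =>
    by_cases h : (cgState A b y₀ k).res = 0
    · rwa [cgState_succ_of_res_eq_zero h]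
    · constructor
      · rw [cgState_succ_dir h, dotProduct_add, hres, dotProduct_smul, ih.1]
        simp
      · rw [cgState_succ_iter h, dotProduct_add, dotProduct_smul, ih.1, ih.2]
        simp

/-- If `p ⬝ᵥ A p = 0`, semidefiniteness puts `p` in the kernel, to which the residual `r` is
orthogonal; then `r ⬝ᵥ r = p ⬝ᵥ r = 0`. -/
lemma cgState_dir_dotProduct_pos (hA : A.PosSemidef)
    (hb : ∀ u, A *ᵥ u = 0 → u ⬝ᵥ b = 0) {k : ℕ} (h : (cgState A b y₀ k).res ≠ 0)
    (hpr : (cgState A b y₀ k).dir ⬝ᵥ (cgState A b y₀ k).res =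
      (cgState A b y₀ k).res ⬝ᵥ (cgState A b y₀ k).res) :
    0 < (cgState A b y₀ k).dir ⬝ᵥ (A *ᵥ (cgState A b y₀ k).dir) := by
  have h0 := hA.dotProduct_mulVec_nonneg (cgState A b y₀ k).dir
  rw [star_trivial] at h0
  refine h0.lt_of_ne' fun hz => h ?_
  have hz' := (hA.dotProduct_mulVec_zero_iff (cgState A b y₀ k).dir).1 (by rwa [star_trivial])
  have := (dotProduct_cgState_of_mulVec_eq_zero hA.1 hb hz' (y₀ := y₀) k).1
  rwa [hpr, dotProduct_self_eq_zero] at this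

/-- The span of the first `k` search directions. -/
noncomputable def cgSpan (A : Matrix ι ι ℝ) (b y₀ : ι → ℝ) (k : ℕ) : Submodule ℝ (ι → ℝ) :=
  Submodule.span ℝ ((fun j => (cgState A b y₀ j).dir) '' Set.Iio k)

lemma cgSpan_mono {j k : ℕ} (h : j ≤ k) : cgSpan A b y₀ j ≤ cgSpan A b y₀ k :=
  Submodule.span_mono (Set.image_mono (Set.Iio_subset_Iio h))

lemma dir_mem_cgSpan {j k : ℕ} (h : j < k) : (cgState A b y₀ j).dir ∈ cgSpan A b y₀ k :=
  Submodule.subset_span ⟨j, h, rfl⟩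

lemma dotProduct_eq_zero_of_mem_cgSpan {k : ℕ} {v w : ι → ℝ}
    (hv : ∀ j < k, v ⬝ᵥ (cgState A b y₀ j).dir = 0) (hw : w ∈ cgSpan A b y₀ k) :
    v ⬝ᵥ w = 0 := by
  induction hw using Submodule.span_induction with
  | mem x hx => obtain ⟨j, hj, rfl⟩ := hx; exact hv j hj
  | zero => simp
  | add x y _ _ hx hy => rw [dotProduct_add, hx, hy, add_zero]
  | smul a x _ hx => rw [dotProduct_smul, hx, smul_zero]

lemma res_mem_cgSpan {k : ℕ} (h : (cgState A b y₀ k).res ≠ 0) :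
    (cgState A b y₀ k).res ∈ cgSpan A b y₀ (k + 1) := by
  cases k with
  | zero => exact dir_mem_cgSpan (Nat.zero_lt_one)
  | succ k =>
    have := cgState_succ_dir (res_ne_zero_of_le k.le_succ h)
    rw [← sub_eq_iff_eq_add] at this
    rw [← this]
    exact sub_mem (dir_mem_cgSpan (Nat.lt_succ_self _))
      (Submodule.smul_mem _ _ (dir_mem_cgSpan (by omega)))

lemma mulVec_cgState_dir (hA : A.PosSemidef) {k : ℕ} (h : (cgState A b y₀ k).res ≠ 0) :
    A *ᵥ (cgState A b y₀ k).dir = (cgStepLength (cgState A b y₀ k) A)⁻¹ •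
      ((cgState A b y₀ k).res - (cgState A b y₀ (k + 1)).res) := by
  rw [cgState_succ_res h, sub_sub_cancel]
  -- A zero step length can only come from division by `p ⬝ᵥ A p = 0`; then `A p = 0`, so both sides
  -- vanish.
  by_cases h0 : cgStepLength (cgState A b y₀ k) A = 0
  · have hz : (cgState A b y₀ k).dir ⬝ᵥ (A *ᵥ (cgState A b y₀ k).dir) = 0 :=
      (div_eq_zero_iff.1 h0).resolve_left (by rwa [dotProduct_self_eq_zero])
    rw [(hA.dotProduct_mulVec_zero_iff (cgState A b y₀ k).dir).1 (by rwa [star_trivial])]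
    simp
  · rw [inv_smul_smul₀ h0]

/-- The orthogonality and conjugacy relations of the conjugate gradient method. -/
lemma cgState_orthogonality (hA : A.PosSemidef)
    (hb : ∀ u, A *ᵥ u = 0 → u ⬝ᵥ b = 0) (k : ℕ) (hk : (cgState A b y₀ k).res ≠ 0) :
    (cgState A b y₀ k).dir ⬝ᵥ (cgState A b y₀ k).res =
      (cgState A b y₀ k).res ⬝ᵥ (cgState A b y₀ k).res ∧
    (∀ j < k, (cgState A b y₀ k).res ⬝ᵥ (cgState A b y₀ j).dir = 0) ∧
    ∀ j < k, (cgState A b y₀ k).dir ⬝ᵥ (A *ᵥ (cgState A b y₀ j).dir) = 0 := by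
  induction k with
  | zero => exact ⟨rfl, by simp, by simp⟩
  | succ k ih =>
    have hk0 := res_ne_zero_of_le k.le_succ hk
    obtain ⟨hpr, hrp, hpp⟩ := ih hk0
    have hpos := cgState_dir_dotProduct_pos hA hb hk0 hpr
    have hrr : (cgState A b y₀ k).res ⬝ᵥ (cgState A b y₀ k).res ≠ 0 := by
      rwa [Ne, dotProduct_self_eq_zero]
    have hr : ∀ j < k + 1, (cgState A b y₀ (k + 1)).res ⬝ᵥ (cgState A b y₀ j).dir = 0 := by
      intro j hj
      rw [cgState_succ_res hk0, sub_dotProduct, smul_dotProduct, hA.1.mulVec_dotProduct_real]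
      -- Older directions are handled by conjugacy, the latest one by the choice of the step length.
      rcases Nat.lt_succ_iff_lt_or_eq.1 hj with hj | rfl
      · rw [hrp j hj, hpp j hj]; simp
      · rw [dotProduct_comm, hpr, cgStepLength, smul_eq_mul, div_mul_cancel₀ _ hpos.ne', sub_self]
    have hrs : ∀ w ∈ cgSpan A b y₀ (k + 1), (cgState A b y₀ (k + 1)).res ⬝ᵥ w = 0 :=
      fun w hw => dotProduct_eq_zero_of_mem_cgSpan hr hw
    refine ⟨?_, hr, fun j hj => ?_⟩
    · conv_lhs => rw [cgState_succ_dir hk0]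
      rw [add_dotProduct, smul_dotProduct, dotProduct_comm (cgState A b y₀ k).dir,
        hr k k.lt_succ_self, smul_zero, add_zero]
    · have hj0 := res_ne_zero_of_le (Nat.lt_succ_iff.1 hj) hk0
      have h1 : (cgState A b y₀ (k + 1)).res ⬝ᵥ (cgState A b y₀ j).res = 0 :=
        hrs _ (cgSpan_mono hj (res_mem_cgSpan hj0))
      rw [cgState_succ_dir hk0, add_dotProduct, smul_dotProduct]
      -- `A p_j` is a multiple of `r_j - r_{j+1}`. For `j < k` both residuals are orthogonal to
      -- `r_{k+1}`; for `j = k` the surviving `r_{k+1} ⬝ᵥ r_{k+1}` is cancelled by the coefficient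
      -- of `p_k` in `p_{k+1}`.
      rcases Nat.lt_succ_iff_lt_or_eq.1 hj with hj' | rfl
      · have h2 : (cgState A b y₀ (k + 1)).res ⬝ᵥ (cgState A b y₀ (j + 1)).res = 0 :=
          hrs _ (cgSpan_mono (by omega) (res_mem_cgSpan (res_ne_zero_of_le hj' hk0)))
        rw [hpp j hj', mulVec_cgState_dir hA hj0, dotProduct_smul, dotProduct_sub, h1, h2]
        simp
      · rw [mulVec_cgState_dir hA hj0, dotProduct_smul, dotProduct_sub, h1,
          ← mulVec_cgState_dir hA hj0, cgStepLength]
        simp only [smul_eq_mul]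
        field_simp
        ring

lemma mulVec_mem_cgSpan (hA : A.PosSemidef) {k : ℕ} (hk : (cgState A b y₀ k).res ≠ 0)
    {w : ι → ℝ} (hw : w ∈ cgSpan A b y₀ k) : A *ᵥ w ∈ cgSpan A b y₀ (k + 1) := by
  induction hw using Submodule.span_induction with
  | mem x hx =>
    obtain ⟨j, hj, rfl⟩ := hx
    have hj : j < k := hj
    dsimp only
    rw [mulVec_cgState_dir hA (res_ne_zero_of_le hj.le hk)]
    exact Submodule.smul_mem _ _ (sub_mem
      (cgSpan_mono (by omega) (res_mem_cgSpan (res_ne_zero_of_le hj.le hk)))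
      (cgSpan_mono (by omega) (res_mem_cgSpan (res_ne_zero_of_le hj hk))))
  | zero => simp
  | add x y _ _ hx hy => rw [Matrix.mulVec_add]; exact add_mem hx hy
  | smul a x _ hx => rw [Matrix.mulVec_smul]; exact Submodule.smul_mem _ _ hx

/-- The search directions span the Krylov space. -/
lemma pow_mulVec_res_mem_cgSpan [DecidableEq ι] (hA : A.PosSemidef) {k : ℕ}
    (hk : (cgState A b y₀ k).res ≠ 0) :
    (A ^ k) *ᵥ (b - A *ᵥ y₀) ∈ cgSpan A b y₀ (k + 1) := by
  induction k with
  | zero =>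
    rw [pow_zero, Matrix.one_mulVec]
    exact dir_mem_cgSpan (A := A) (b := b) (y₀ := y₀) Nat.zero_lt_one
  | succ k ih =>
    rw [pow_succ', ← Matrix.mulVec_mulVec]
    exact mulVec_mem_cgSpan hA hk (ih (res_ne_zero_of_le k.le_succ hk))

lemma cgIter_sub_mem_cgSpan (k : ℕ) : cgIter A b y₀ k - y₀ ∈ cgSpan A b y₀ k := by
  induction k with
  | zero => simp [cgIter, cgState]
  | succ k ih =>
    have ih := cgSpan_mono k.le_succ ih
    by_cases h : (cgState A b y₀ k).res = 0
    · rwa [cgIter, cgState_succ_of_res_eq_zero h]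
    · rw [cgIter, cgState_succ_iter h, add_sub_right_comm]
      exact add_mem ih (Submodule.smul_mem _ _ (dir_mem_cgSpan k.lt_succ_self))

/-- Since `q(0) = 1`, every term of `q(A) - 1` contains a factor `A`, and `A (y₀ - y)` is minus the
initial residual: only Krylov vectors `A ^ j r₀` with `j < k` remain. -/
lemma aeval_mulVec_sub_mem_cgSpan [DecidableEq ι] (hA : A.PosSemidef) {k : ℕ}
    (hk : (cgState A b y₀ k).res ≠ 0) {y : ι → ℝ} (hy : A *ᵥ y = b) {q : Polynomial ℝ}
    (hq : q.natDegree ≤ k) (hq0 : q.eval 0 = 1) :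
    Polynomial.aeval A q *ᵥ (y₀ - y) - (y₀ - y) ∈ cgSpan A b y₀ k := by
  have hc : q.coeff 0 = 1 := by rwa [Polynomial.coeff_zero_eq_eval_zero]
  rw [Polynomial.aeval_eq_sum_range' (Nat.lt_succ_of_le hq), Finset.sum_range_succ', hc,
    pow_zero, one_smul, Matrix.add_mulVec, Matrix.one_mulVec, add_sub_cancel_right,
    Matrix.sum_mulVec]
  refine Submodule.sum_mem _ fun j hj => ?_
  have hj := Finset.mem_range.1 hj
  have hy' : A *ᵥ (y₀ - y) = -(b - A *ᵥ y₀) := by rw [Matrix.mulVec_sub, hy, neg_sub]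
  rw [Matrix.smul_mulVec, pow_succ, ← Matrix.mulVec_mulVec, hy', Matrix.mulVec_neg]
  exact Submodule.smul_mem _ _ (neg_mem (cgSpan_mono hj
    (pow_mulVec_res_mem_cgSpan hA (res_ne_zero_of_le hj.le hk))))

/-- The iterates minimize the energy norm of the error over the Krylov space. -/
lemma energyNorm_cgIter_sub_le_aeval [DecidableEq ι] (hA : A.PosSemidef)
    (hb : ∀ u, A *ᵥ u = 0 → u ⬝ᵥ b = 0) {y : ι → ℝ} (hy : A *ᵥ y = b) {k : ℕ}
    {q : Polynomial ℝ} (hq : q.natDegree ≤ k) (hq0 : q.eval 0 = 1) :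
    energyNorm A (cgIter A b y₀ k - y) ≤ energyNorm A (Polynomial.aeval A q *ᵥ (y₀ - y)) := by
  refine Real.sqrt_le_sqrt ?_
  have hAe : A *ᵥ (cgIter A b y₀ k - y) = -(cgState A b y₀ k).res := by
    rw [Matrix.mulVec_sub, hy, cgState_res_eq, neg_sub, cgIter]
  set e := cgIter A b y₀ k - y with he
  set v := Polynomial.aeval A q *ᵥ (y₀ - y) with hv
  have h0 := hA.dotProduct_mulVec_nonneg (v - e)
  have hsym := hA.1.mulVec_dotProduct_real
  rw [star_trivial] at h0
  -- Pythagoras in the energy form: the competitor `v` differs from the error `e` by an element of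
  -- the span, and `A e` is minus the residual, which is orthogonal to that span.
  suffices h : (v - e) ⬝ᵥ (A *ᵥ e) = 0 by
    have h1 : e ⬝ᵥ (A *ᵥ (v - e)) = 0 := by rw [← hsym, dotProduct_comm, h]
    have h2 : v ⬝ᵥ (A *ᵥ v) = e ⬝ᵥ (A *ᵥ e) + (v - e) ⬝ᵥ (A *ᵥ e) + e ⬝ᵥ (A *ᵥ (v - e)) +
        (v - e) ⬝ᵥ (A *ᵥ (v - e)) := by
      simp only [Matrix.mulVec_sub, dotProduct_sub, sub_dotProduct]
      ring
    linarith
  rw [hAe]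
  by_cases hk : (cgState A b y₀ k).res = 0
  · simp [hk]
  · have hmem : v - e ∈ cgSpan A b y₀ k := by
      have := sub_mem (aeval_mulVec_sub_mem_cgSpan hA hk hy hq hq0) (cgIter_sub_mem_cgSpan k)
      convert this using 1
      rw [he, hv]
      abel
    rw [dotProduct_neg, dotProduct_comm,
      dotProduct_eq_zero_of_mem_cgSpan (cgState_orthogonality hA hb k hk).2.1 hmem, neg_zero]

end CG

/-! ### Convergence -/

lemma Matrix.PosSemidef.pos_of_mem_nonzeroEigenvalues {ι : Type*} [Fintype ι] [DecidableEq ι]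
    {A : Matrix ι ι ℝ} (hA : A.PosSemidef) {x : ℝ} (hx : x ∈ nonzeroEigenvalues A) : 0 < x := by
  obtain ⟨hx0, hx⟩ := hx
  obtain ⟨v, hv⟩ := hx.exists_hasEigenvector
  have hAv : A *ᵥ v = x • v := by simpa using hv.apply_eq_smul
  have h0 := hA.dotProduct_mulVec_nonneg v
  have hvv : 0 < v ⬝ᵥ v := by
    simpa using Matrix.dotProduct_star_self_pos_iff.2 hv.2
  rw [star_trivial, hAv, dotProduct_smul, smul_eq_mul] at h0
  exact (nonneg_of_mul_nonneg_left h0 hvv).lt_of_ne' hx0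

/-- In an eigenbasis, `q(A)` multiplies the `i`-th coordinate by `q(l i)`, and the energy weights
its square by `l i`; so the values of `q` matter only at nonzero eigenvalues. -/
lemma energyNorm_aeval_mulVec_le {ι : Type*} [Fintype ι] [DecidableEq ι] {A : Matrix ι ι ℝ}
    (hA : A.PosSemidef) {q : Polynomial ℝ} {C : ℝ} (hC : 0 ≤ C)
    (hq : ∀ x ∈ nonzeroEigenvalues A, |q.eval x| ≤ C) (v : ι → ℝ) :
    energyNorm A (Polynomial.aeval A q *ᵥ v) ≤ C * energyNorm A v := by
  obtain ⟨u, l, hu, hsum, hl⟩ := hA.1.exists_dotProduct_eigenbasis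
  have hA' : ∀ i w, u i ⬝ᵥ (A *ᵥ w) = l i * (u i ⬝ᵥ w) := fun i w => by
    rw [← hA.1.mulVec_dotProduct_real, hu, smul_dotProduct, smul_eq_mul]
  rw [energyNorm, energyNorm, ← Real.sqrt_sq hC, ← Real.sqrt_mul (sq_nonneg C)]
  refine Real.sqrt_le_sqrt ?_
  rw [hsum, hsum v, Finset.mul_sum]
  refine Finset.sum_le_sum fun i _ => ?_
  rw [hA', hA', Matrix.mulVec_aeval_of_mulVec_eq_smul hA.1 (hu i)]
  by_cases h0 : l i = 0
  · simp [h0]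
  have hmem : l i ∈ nonzeroEigenvalues A := ⟨h0, (hl _).2 ⟨i, rfl⟩⟩
  have hpos := hA.pos_of_mem_nonzeroEigenvalues hmem
  have h1 : q.eval (l i) ^ 2 ≤ C ^ 2 := sq_le_sq' (abs_le.1 (hq _ hmem)).1 (abs_le.1 (hq _ hmem)).2
  calc _ = q.eval (l i) ^ 2 * (l i * (u i ⬝ᵥ v) ^ 2) := by ring
    _ ≤ C ^ 2 * (l i * (u i ⬝ᵥ v) ^ 2) := by gcongr
    _ = _ := by ring

lemma energyNorm_le_sqrt_mul_euclNorm {ι : Type*} [Fintype ι] [DecidableEq ι] {A : Matrix ι ι ℝ}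
    (hA : A.PosSemidef) {a : ℝ} (ha : 0 ≤ a) (h : ∀ x ∈ nonzeroEigenvalues A, x ≤ a)
    (v : ι → ℝ) : energyNorm A v ≤ √a * euclNorm v := by
  obtain ⟨u, l, hu, hsum, hl⟩ := hA.1.exists_dotProduct_eigenbasis
  rw [energyNorm, euclNorm, ← Real.sqrt_mul ha]
  refine Real.sqrt_le_sqrt ?_
  rw [hsum, hsum v, Finset.mul_sum]
  refine Finset.sum_le_sum fun i _ => ?_
  rw [← hA.1.mulVec_dotProduct_real, hu, smul_dotProduct, smul_eq_mul, mul_left_comm]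
  refine mul_le_mul_of_nonneg_right ?_ (mul_self_nonneg _)
  by_cases h0 : l i = 0
  · rwa [h0]
  · exact h _ ⟨h0, (hl _).2 ⟨i, rfl⟩⟩

lemma sqrt_mul_euclNorm_le_energyNorm {ι : Type*} [Fintype ι] [DecidableEq ι] {A : Matrix ι ι ℝ}
    (hA : A.PosSemidef) {c : ℝ} (hc : 0 ≤ c) (h : ∀ x ∈ nonzeroEigenvalues A, c ≤ x)
    {v : ι → ℝ} (hv : ∀ u, A *ᵥ u = 0 → u ⬝ᵥ v = 0) : √c * euclNorm v ≤ energyNorm A v := by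
  obtain ⟨u, l, hu, hsum, hl⟩ := hA.1.exists_dotProduct_eigenbasis
  rw [energyNorm, euclNorm, ← Real.sqrt_mul hc]
  refine Real.sqrt_le_sqrt ?_
  rw [hsum, hsum v (A *ᵥ v), Finset.mul_sum]
  refine Finset.sum_le_sum fun i _ => ?_
  rw [← hA.1.mulVec_dotProduct_real, hu, smul_dotProduct, smul_eq_mul, mul_left_comm _ (l i)]
  by_cases h0 : l i = 0
  · rw [hv (u i) (by rw [hu, h0, zero_smul])]
    simp
  · exact mul_le_mul_of_nonneg_right (h _ ⟨h0, (hl _).2 ⟨i, rfl⟩⟩) (mul_self_nonneg _)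

lemma Matrix.IsHermitian.finite_nonzeroEigenvalues {ι : Type*} [Fintype ι] [DecidableEq ι]
    {A : Matrix ι ι ℝ} (hA : A.IsHermitian) : (nonzeroEigenvalues A).Finite := by
  obtain ⟨u, l, hu, hsum, hl⟩ := hA.exists_dotProduct_eigenbasis
  exact (Set.finite_range l).subset fun x hx => (hl x).1 hx.2

lemma Matrix.IsHermitian.nonempty_nonzeroEigenvalues {ι : Type*} [Fintype ι] [DecidableEq ι]
    {A : Matrix ι ι ℝ} (hA : A.IsHermitian) (hA0 : A ≠ 0) : (nonzeroEigenvalues A).Nonempty := by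
  obtain ⟨u, l, hu, hsum, hl⟩ := hA.exists_dotProduct_eigenbasis
  by_contra hne
  rw [Set.not_nonempty_iff_eq_empty] at hne
  have hl0 : ∀ i, l i = 0 := fun i => by
    by_contra h0
    have : l i ∈ nonzeroEigenvalues A := ⟨h0, (hl _).2 ⟨i, rfl⟩⟩
    rw [hne] at this
    exact this
  refine hA0 (Matrix.ext_of_mulVec_single fun j => ?_)
  refine dotProduct_eq _ _ fun w => ?_
  rw [hA.mulVec_dotProduct_real, hsum, Matrix.zero_mulVec, zero_dotProduct]
  refine Finset.sum_eq_zero fun i _ => ?_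
  rw [← hA.mulVec_dotProduct_real, hu, hl0]
  simp

lemma abs_apply_le_euclNorm {ι : Type*} [Fintype ι] (v : ι → ℝ) (i : ι) : |v i| ≤ euclNorm v := by
  rw [← Real.sqrt_sq_eq_abs, sq]
  exact Real.sqrt_le_sqrt
    (Finset.single_le_sum (f := fun i => v i * v i) (fun j _ => mul_self_nonneg _)
      (Finset.mem_univ i))

/-- Convergence of the conjugate gradient method for a consistent system with a nonzero positive
semidefinite matrix. -/
theorem conjugateGradient_convergence {ι : Type*} [Fintype ι] [DecidableEq ι] {A : Matrix ι ι ℝ}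
    (hA : A.PosSemidef) (hA0 : A ≠ 0) {b : ι → ℝ}
    (hb : ∀ u, A *ᵥ u = 0 → u ⬝ᵥ b = 0) :
    ∃ lam₁ lamᵣ : ℝ,
      IsGreatest (nonzeroEigenvalues A) lam₁ ∧ IsLeast (nonzeroEigenvalues A) lamᵣ ∧
      0 < lamᵣ ∧
      0 ≤ cgRate lam₁ lamᵣ ∧ cgRate lam₁ lamᵣ < 1 ∧
      ∀ y₀ : ι → ℝ,
        (∀ k : ℕ, (cgState A b y₀ k).res ≠ 0 →
          0 < (cgState A b y₀ k).dir ⬝ᵥ (A *ᵥ (cgState A b y₀ k).dir)) ∧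
        (∀ y : ι → ℝ, A *ᵥ y = b → ∀ k : ℕ,
          energyNorm A (cgIter A b y₀ k - y) ≤
            2 * cgRate lam₁ lamᵣ ^ k * energyNorm A (y₀ - y)) ∧
        (∃ y : ι → ℝ, A *ᵥ y = b ∧
          Filter.Tendsto (cgIter A b y₀) Filter.atTop (nhds y) ∧
          ∀ k : ℕ, euclNorm (cgIter A b y₀ k - y) ≤
            2 * √(lam₁ / lamᵣ) * cgRate lam₁ lamᵣ ^ k * euclNorm (y₀ - y)) := by
  have hfin := hA.1.finite_nonzeroEigenvalues
  have hne := hA.1.nonempty_nonzeroEigenvalues hA0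
  obtain ⟨lam₁, h1⟩ := hfin.isCompact.exists_isGreatest hne
  obtain ⟨lamᵣ, hr⟩ := hfin.isCompact.exists_isLeast hne
  have hr0 := hA.pos_of_mem_nonzeroEigenvalues hr.1
  have h10 := hA.pos_of_mem_nonzeroEigenvalues h1.1
  have hle : lamᵣ ≤ lam₁ := hr.2 h1.1
  have hρ0 := cgRate_nonneg hr0 hle
  have hρ1 := cgRate_lt_one lam₁ lamᵣ
  refine ⟨lam₁, lamᵣ, h1, hr, hr0, hρ0, hρ1, fun y₀ => ⟨fun k hk =>
    cgState_dir_dotProduct_pos hA hb hk (cgState_orthogonality hA hb k hk).1, ?_⟩⟩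
  have hen : ∀ y : ι → ℝ, A *ᵥ y = b → ∀ k : ℕ, energyNorm A (cgIter A b y₀ k - y) ≤
      2 * cgRate lam₁ lamᵣ ^ k * energyNorm A (y₀ - y) := by
    intro y hy k
    obtain ⟨q, hq, hq0, hqC⟩ := exists_polynomial_abs_eval_le_cgRate hr0 hle k
    exact (energyNorm_cgIter_sub_le_aeval hA hb hy hq hq0).trans
      (energyNorm_aeval_mulVec_le hA (by positivity) (fun x hx => hqC x (hr.2 hx) (h1.2 hx)) _)
  refine ⟨hen, ?_⟩
  -- The limit is the solution `y₀ + A w`: its difference from `y₀` lies in the range of `A`, so it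
  -- has the same kernel component as every iterate.
  obtain ⟨w, hw⟩ := hA.1.exists_mulVec_mulVec_eq (b := b - A *ᵥ y₀) fun u hu =>
    (dotProduct_cgState_of_mulVec_eq_zero hA.1 hb hu (y₀ := y₀) 0).1
  have hy : A *ᵥ (y₀ + A *ᵥ w) = b := by rw [Matrix.mulVec_add, hw, add_sub_cancel]
  have hker : ∀ k u, A *ᵥ u = 0 → u ⬝ᵥ (cgIter A b y₀ k - (y₀ + A *ᵥ w)) = 0 := by
    intro k u hu
    rw [dotProduct_sub, dotProduct_add, cgIter,
      (dotProduct_cgState_of_mulVec_eq_zero hA.1 hb hu k).2.2, ← hA.1.mulVec_dotProduct_real, hu]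
    simp
  have hbound : ∀ k : ℕ, euclNorm (cgIter A b y₀ k - (y₀ + A *ᵥ w)) ≤
      2 * √(lam₁ / lamᵣ) * cgRate lam₁ lamᵣ ^ k * euclNorm (y₀ - (y₀ + A *ᵥ w)) := by
    intro k
    have hs : 0 < √lamᵣ := Real.sqrt_pos.2 hr0
    rw [← mul_le_mul_iff_right₀ hs]
    calc _ ≤ _ := sqrt_mul_euclNorm_le_energyNorm hA hr0.le (fun x hx => hr.2 hx) (hker k)
      _ ≤ _ := hen _ hy k
      _ ≤ 2 * cgRate lam₁ lamᵣ ^ k * (√lam₁ * euclNorm (y₀ - (y₀ + A *ᵥ w))) := by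
        gcongr
        exact energyNorm_le_sqrt_mul_euclNorm hA h10.le (fun x hx => h1.2 hx) _
      _ = _ := by
        rw [Real.sqrt_div h10.le]
        field_simp
  refine ⟨y₀ + A *ᵥ w, hy, tendsto_pi_nhds.2 fun i => ?_, hbound⟩
  have hlim : Filter.Tendsto (fun k : ℕ => 2 * √(lam₁ / lamᵣ) * cgRate lam₁ lamᵣ ^ k *
      euclNorm (y₀ - (y₀ + A *ᵥ w))) Filter.atTop (nhds 0) := by
    simpa using ((tendsto_pow_atTop_nhds_zero_of_lt_one hρ0 hρ1).const_mul
      (2 * √(lam₁ / lamᵣ))).mul_const (euclNorm (y₀ - (y₀ + A *ᵥ w)))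
  rw [tendsto_iff_dist_tendsto_zero]
  refine squeeze_zero (fun _ => dist_nonneg) (fun k => ?_) hlim
  rw [Real.dist_eq]
  exact (abs_apply_le_euclNorm (cgIter A b y₀ k - (y₀ + A *ᵥ w)) i).trans (hbound k)

/-! ### The adjoint system -/

section Adjoint

variable {n m : ℕ} {μ : Fin n → ℝ} {ν : Fin m → ℝ} {T : Matrix (Fin n) (Fin m) ℝ}

/-- Writing `μ` and `ν` as row and column sums of `T` spreads the diagonal terms over the entries,
where they complete the squares. -/
lemma IsTransportPlan.dotProduct_adjointMatrix_mulVec (hT : IsTransportPlan μ ν T)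
    (v : Fin n ⊕ Fin m → ℝ) :
    v ⬝ᵥ (adjointMatrix μ ν T *ᵥ v) =
      ∑ i, ∑ j, T i j * (v (Sum.inl i) + v (Sum.inr j)) ^ 2 := by
  have h1 : ∑ i, ∑ j, T i j * v (Sum.inr j) ^ 2 = ∑ j, ν j * v (Sum.inr j) ^ 2 := by
    rw [Finset.sum_comm, ← hT.col_sum]
    simp [Matrix.mulVec, dotProduct, Finset.sum_mul]
  have h2 : ∑ i, ∑ j, T i j * v (Sum.inl i) ^ 2 = ∑ i, μ i * v (Sum.inl i) ^ 2 := by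
    rw [← hT.row_sum]
    simp [Matrix.mulVec, dotProduct, Finset.sum_mul]
  have h3 : ∑ j, v (Sum.inr j) * ∑ i, T i j * v (Sum.inl i) =
      ∑ i, ∑ j, T i j * v (Sum.inl i) * v (Sum.inr j) := by
    rw [Finset.sum_comm]
    simp only [Finset.mul_sum]
    exact Finset.sum_congr rfl fun _ _ => Finset.sum_congr rfl fun _ _ => by ring
  have h4 : ∑ i, v (Sum.inl i) * ∑ j, T i j * v (Sum.inr j) =
      ∑ i, ∑ j, T i j * v (Sum.inl i) * v (Sum.inr j) := by
    simp only [Finset.mul_sum]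
    exact Finset.sum_congr rfl fun _ _ => Finset.sum_congr rfl fun _ _ => by ring
  have hL : v ⬝ᵥ (adjointMatrix μ ν T *ᵥ v) =
      (∑ i, μ i * v (Sum.inl i) ^ 2 + ∑ i, v (Sum.inl i) * ∑ j, T i j * v (Sum.inr j)) +
      (∑ j, v (Sum.inr j) * ∑ i, T i j * v (Sum.inl i) + ∑ j, ν j * v (Sum.inr j) ^ 2) := by
    rw [adjointMatrix, Matrix.fromBlocks_mulVec, dotProduct, Fintype.sum_sum_type]
    simp only [Sum.elim_inl, Sum.elim_inr, Pi.add_apply, mul_add, Finset.sum_add_distrib,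
      Matrix.mulVec_diagonal]
    congr 2
    · exact Finset.sum_congr rfl fun _ _ => by simp only [Function.comp]; ring
    · exact Finset.sum_congr rfl fun _ _ => by simp only [Function.comp]; ring
  have hR : ∀ i j, T i j * (v (Sum.inl i) + v (Sum.inr j)) ^ 2 = T i j * v (Sum.inl i) ^ 2 +
      T i j * v (Sum.inr j) ^ 2 + 2 * (T i j * v (Sum.inl i) * v (Sum.inr j)) := fun _ _ => by ring
  simp only [hR, Finset.sum_add_distrib, ← Finset.mul_sum]
  rw [hL, h1, h2, h3, h4]
  ring

lemma IsTransportPlan.posSemidef_adjointMatrix (hT : IsTransportPlan μ ν T) :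
    (adjointMatrix μ ν T).PosSemidef := by
  refine .of_dotProduct_mulVec_nonneg ?_ fun v => ?_
  · simp [adjointMatrix, Matrix.IsHermitian, Matrix.fromBlocks_transpose]
  · rw [star_trivial, hT.dotProduct_adjointMatrix_mulVec]
    exact Finset.sum_nonneg fun i _ => Finset.sum_nonneg fun j _ =>
      mul_nonneg (hT.nonneg i j) (sq_nonneg _)

lemma dotProduct_adjointRhs (T G : Matrix (Fin n) (Fin m) ℝ) (v : Fin n ⊕ Fin m → ℝ) :
    v ⬝ᵥ adjointRhs T G = ∑ i, ∑ j, G i j * (T i j * (v (Sum.inl i) + v (Sum.inr j))) := by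
  simp only [mul_add, Finset.sum_add_distrib]
  rw [Finset.sum_comm (f := fun i j => G i j * (T i j * v (Sum.inr j))), adjointRhs, dotProduct,
    Fintype.sum_sum_type]
  simp only [Sum.elim_inl, Sum.elim_inr, Matrix.mulVec, dotProduct, Matrix.hadamard_apply,
    Matrix.transpose_apply, Pi.one_apply, mul_one, Finset.mul_sum]
  congr 1 <;> exact Finset.sum_congr rfl fun _ _ => Finset.sum_congr rfl fun _ _ => by ring

/-- The adjoint system is consistent: its right-hand side is orthogonal to the kernel. -/
lemma IsTransportPlan.dotProduct_adjointRhs_eq_zero (hT : IsTransportPlan μ ν T)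
    (G : Matrix (Fin n) (Fin m) ℝ) {v : Fin n ⊕ Fin m → ℝ}
    (hv : adjointMatrix μ ν T *ᵥ v = 0) : v ⬝ᵥ adjointRhs T G = 0 := by
  have h := hT.dotProduct_adjointMatrix_mulVec v
  rw [hv, dotProduct_zero, eq_comm] at h
  have hnn : ∀ i j, 0 ≤ T i j * (v (Sum.inl i) + v (Sum.inr j)) ^ 2 := fun i j =>
    mul_nonneg (hT.nonneg i j) (sq_nonneg _)
  rw [dotProduct_adjointRhs]
  refine Finset.sum_eq_zero fun i _ => Finset.sum_eq_zero fun j _ => ?_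
  have hi := (Finset.sum_eq_zero_iff_of_nonneg fun i _ =>
    Finset.sum_nonneg fun j _ => hnn i j).1 h i (Finset.mem_univ i)
  have hij := (Finset.sum_eq_zero_iff_of_nonneg fun j _ => hnn i j).1 hi j (Finset.mem_univ j)
  -- A vanishing sum of nonnegative terms forces `T i j = 0` or `v_i + v_j = 0`; either kills the
  -- matching term of `v ⬝ᵥ b`, whatever `G i j` is.
  rcases mul_eq_zero.1 hij with h0 | h0
  · simp [h0]
  · simp [pow_eq_zero_iff two_ne_zero |>.1 h0]

lemma adjointMatrix_ne_zero (hμ : μ ∈ stdSimplex ℝ (Fin n)) : adjointMatrix μ ν T ≠ 0 := by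
  intro h
  have h0 : ∀ i, μ i = 0 := fun i => by
    simpa [adjointMatrix] using congrFun (congrFun h (Sum.inl i)) (Sum.inl i)
  have := hμ.2
  simp [h0] at this

end Adjoint

theorem theorem2 {n m : ℕ}
    (μ : Fin n → ℝ) (hμ : μ ∈ stdSimplex ℝ (Fin n))
    (ν : Fin m → ℝ) (hν : ν ∈ stdSimplex ℝ (Fin m))
    (T : Matrix (Fin n) (Fin m) ℝ) (hT : IsTransportPlan μ ν T)
    (f : Matrix (Fin n) (Fin m) ℝ → ℝ) (G : Matrix (Fin n) (Fin m) ℝ)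
    (hG : HasMatrixGradientAt f G T)
    (A : Matrix (Fin n ⊕ Fin m) (Fin n ⊕ Fin m) ℝ) (hA : A = adjointMatrix μ ν T)
    (b : Fin n ⊕ Fin m → ℝ) (hb : b = adjointRhs T G) :
    ∃ lam₁ lamᵣ : ℝ,
      IsGreatest (nonzeroEigenvalues A) lam₁ ∧ IsLeast (nonzeroEigenvalues A) lamᵣ ∧
      0 < lamᵣ ∧
      0 ≤ cgRate lam₁ lamᵣ ∧ cgRate lam₁ lamᵣ < 1 ∧
      ∀ y₀ : Fin n ⊕ Fin m → ℝ,
        -- the method is well defined: no breakdown before the residual vanishes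
        (∀ k : ℕ, (cgState A b y₀ k).res ≠ 0 →
          0 < (cgState A b y₀ k).dir ⬝ᵥ (A *ᵥ (cgState A b y₀ k).dir)) ∧
        -- the error bound in the energy norm, relative to every solution of the system
        (∀ y : Fin n ⊕ Fin m → ℝ, A *ᵥ y = b → ∀ k : ℕ,
          energyNorm A (cgIter A b y₀ k - y) ≤
            2 * cgRate lam₁ lamᵣ ^ k * energyNorm A (y₀ - y)) ∧
        -- convergence of the iterates to a solution, at the linear rate
        (∃ y : Fin n ⊕ Fin m → ℝ, A *ᵥ y = b ∧
          Filter.Tendsto (cgIter A b y₀) Filter.atTop (nhds y) ∧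
          ∀ k : ℕ, euclNorm (cgIter A b y₀ k - y) ≤
            2 * √(lam₁ / lamᵣ) * cgRate lam₁ lamᵣ ^ k * euclNorm (y₀ - y)) := by
  subst hA hb
  exact conjugateGradient_convergence hT.posSemidef_adjointMatrix (adjointMatrix_ne_zero hμ)
    fun _ hu => hT.dotProduct_adjointRhs_eq_zero G hu
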